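/- Let $p\ge 1$ and $q,n,m\ge 0$ be integers, let $J^{k}$ denote the $k$-th order jet space of $\mathbb{R}^p\times\mathbb{R}^q$, with coordinates $(x,u^{(k)})=(x^i,u^\alpha_J)$, $1\le i\le p$, $1\le\alpha\le q$, $J$ an (unordered) multi-index in $\{1,\dots,p\}$ with $|J|\le k$, and let $L_{12}=L_{12}(x,u^{(n)},y,v^{(m)})$ be a smooth function $J^{n}\times J^{m}\to\mathbb{R}$ (a non-local Lagrangian). Define the total derivatives $$D^1_i=\frac{\partial}{\partial x^i}+\sum_{\alpha=1}^{q}\sum_J u^\alpha_{J,i}\frac{\partial}{\partial u^\alpha_J},\qquad D^2_i=\frac{\partial}{\partial y^i}+\sum_{\alpha=1}^{q}\sum_J v^\alpha_{J,i}\frac{\partial}{\partial v^\alpha_J},$$ where $u^\alpha_{J,i}$ is the coordinate whose multi-index is $J$ with $i$ adjoined (likewise for $v$), and the Euler operators $E^1=(E^1_\alpha)_{\alpha=1}^q$, $E^2=(E^2_\alpha)_{\alpha=1}^q$, $$E^1_\alpha=\sum_J(-1)^{|J|}D^1_J\frac{\partial}{\partial u^\alpha_J},\qquad E^2_\alpha=\sum_J(-1)^{|J|}D^2_J\frac{\partial}{\partial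 v^\alpha_J},$$ where $D^k_J=D^k_{j_1}\cdots D^k_{j_r}$ for $J=(j_1,\dots,j_r)$. Put $\mathfrak{D}_i=D^1_i$ for $1\le i\le p$, $\mathfrak{D}_i=D^2_{i-p}$ for $p+1\le i\le 2p$, and $M=\mathrm{diag}(\mathbb{1}_p,-\mathbb{1}_p)$. Then $E^1_\alpha(L_{12})=E^2_\alpha(L_{12})=0$ for all $\alpha$, identically in $x,u,y,v$ and the derivatives of $u$ and $v$, if and only if there exists an antisymmetric $2p\times 2p$ matrix $Q_{12}$, whose entries are smooth functions of $x,u,y,v$ and finitely many derivatives of $u$ and $v$, such that $$L_{12}=\frac12\sum_{i,j=1}^{2p}\mathfrak{D}_i\mathfrak{D}_j\,(M\cdot Q_{12})_{ij}.$$ -/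

import Mathlib

open scoped ContDiff

noncomputable section

namespace NonlocalJet

/-- Multi-indices over `p` independent variables: `J i` is the number of occurrences of `i`. -/
abbrev MultiIndex (p : ℕ) : Type := Fin p → ℕ

/-- Multi-indices of order `|J| = ∑ i, J i` at most `n`. -/
abbrev MultiIndexLE (p n : ℕ) : Type := {J : MultiIndex p // ∑ i, J i ≤ n}

instance instFintypeMultiIndexLE (p n : ℕ) : Fintype (MultiIndexLE p n) :=
  Fintype.ofInjective
    (fun J : MultiIndexLE p n => fun i : Fin p =>
      (⟨J.1 i, Nat.lt_succ_of_le
        ((Finset.single_le_sum (f := J.1) (fun _ _ => Nat.zero_le _)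
          (Finset.mem_univ i)).trans J.2)⟩ : Fin (n + 1)))
    (fun J K h => by
      apply Subtype.ext
      funext i
      exact congrArg Fin.val (congrFun h i))

/-- The `n`-th order jet space of `ℝ^p × ℝ^q`: points `(x, u^(n))`, where `u^(n)` lists the
coordinates `u^α_J` with `|J| ≤ n`. -/
abbrev Jet (p q n : ℕ) : Type := (Fin p → ℝ) × (Fin q × MultiIndexLE p n → ℝ)

/-- The space of jets of all orders: points `(x, u^α_J)` with `J` arbitrary. It only serves as a
common domain for functions of the derivatives of `u` up to some finite order. -/
abbrev InfJet (p q : ℕ) : Type := (Fin p → ℝ) × (Fin q × MultiIndex p → ℝ)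

/-- Truncation of a jet at order `n`. -/
def truncate (p q n : ℕ) (z : InfJet p q) : Jet p q n :=
  (z.1, fun c => z.2 (c.1, c.2.1))

/-- A function on `J^n × J^m`, regarded as a function of all jet coordinates. -/
def lift {p q n m : ℕ} (f : Jet p q n × Jet p q m → ℝ) : InfJet p q × InfJet p q → ℝ :=
  fun z => f (truncate p q n z.1, truncate p q m z.2)

/-- Smooth functions of `x, u, y, v` and finitely many derivatives of `u` and `v`. -/
def IsSmooth {p q : ℕ} (F : InfJet p q × InfJet p q → ℝ) : Prop :=
  ∃ (k l : ℕ) (f : Jet p q k × Jet p q l → ℝ), ContDiff ℝ ∞ f ∧ F = lift f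

/-- The partial derivative `∂f/∂x^i`. -/
def partialX {p q : ℕ} (i : Fin p) (f : InfJet p q → ℝ) : InfJet p q → ℝ :=
  fun z => lineDeriv ℝ f z (Pi.single i 1, 0)

/-- The partial derivative `∂f/∂u^α_J`. -/
def partialU {p q : ℕ} (α : Fin q) (J : MultiIndex p) (f : InfJet p q → ℝ) : InfJet p q → ℝ :=
  fun z => lineDeriv ℝ f z (0, Pi.single (α, J) 1)

/-- The total derivative `D_i f = ∂f/∂x^i + ∑_α ∑_J u^α_{J,i} ∂f/∂u^α_J`
(the sum over `J` is finite for functions of finite order). -/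
def totalDeriv {p q : ℕ} (i : Fin p) (f : InfJet p q → ℝ) : InfJet p q → ℝ :=
  fun z => partialX i f z +
    ∑ α : Fin q, ∑ᶠ J : MultiIndex p, z.2 (α, J + Pi.single i 1) * partialU α J f z

/-- The iterated total derivative `D_J = D_1^{J_1} ⋯ D_p^{J_p}`. -/
def totalDerivMulti {p q : ℕ} (J : MultiIndex p) (f : InfJet p q → ℝ) : InfJet p q → ℝ :=
  (List.finRange p).foldr (fun i g => (totalDeriv i)^[J i] g) f

/-- The Euler operator `E_α f = ∑_J (-D)_J (∂f/∂u^α_J)` of the component `α` of the field. -/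
def euler {p q : ℕ} (α : Fin q) (f : InfJet p q → ℝ) : InfJet p q → ℝ :=
  fun z => ∑ᶠ J : MultiIndex p, (-1 : ℝ) ^ (∑ i, J i) * totalDerivMulti J (partialU α J f) z

/-- `E^1_α`: the Euler operator in the first jet variable `(x, u)`. -/
def euler₁ {p q : ℕ} (α : Fin q) (F : InfJet p q × InfJet p q → ℝ) :
    InfJet p q × InfJet p q → ℝ :=
  fun z => euler α (fun a => F (a, z.2)) z.1

/-- `E^2_α`: the Euler operator in the second jet variable `(y, v)`. -/
def euler₂ {p q : ℕ} (α : Fin q) (F : InfJet p q × InfJet p q → ℝ) :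
    InfJet p q × InfJet p q → ℝ :=
  fun z => euler α (fun b => F (z.1, b)) z.2

/-- `D^1_i`: the total derivative with respect to `x^i`. -/
def totalDeriv₁ {p q : ℕ} (i : Fin p) (F : InfJet p q × InfJet p q → ℝ) :
    InfJet p q × InfJet p q → ℝ :=
  fun z => totalDeriv i (fun a => F (a, z.2)) z.1

/-- `D^2_i`: the total derivative with respect to `y^i`. -/
def totalDeriv₂ {p q : ℕ} (i : Fin p) (F : InfJet p q × InfJet p q → ℝ) :
    InfJet p q × InfJet p q → ℝ :=
  fun z => totalDeriv i (fun b => F (z.1, b)) z.2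

/-- The `2p` total derivatives: those in `x` on the first block of indices, those in `y` on the
second one. -/
def frakD {p q : ℕ} : Fin p ⊕ Fin p →
    (InfJet p q × InfJet p q → ℝ) → (InfJet p q × InfJet p q → ℝ)
  | Sum.inl i => totalDeriv₁ i
  | Sum.inr i => totalDeriv₂ i

/-- The constant matrix `M = diag(1_p, -1_p)`, over the ring of functions of the jets. -/
def matM (p q : ℕ) :
    Matrix (Fin p ⊕ Fin p) (Fin p ⊕ Fin p) (InfJet p q × InfJet p q → ℝ) :=
  Matrix.fromBlocks 1 0 0 (-1)

end NonlocalJet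

end

/-! The core is a one-sided statement (`mem_divergences_of_mem_eulerKer`): if `E F = 0` in one of
the two jets, then `F = ∑ D_i P_i`, with each `P_i` obtained from `F` by operators touching that jet
only. Scaling `u` to `tu` and integrating `dF/dt` writes `F(x,u) - F(x,0)` as `∑ u^α_J
A(∂F/∂u^α_J)`, where `A` averages over `t` and commutes with every `D_i`. Integration by parts turns
this, modulo divergences, into `∑ u^α A(E_α F) = 0`. The remainder `F(x,0)` is a total derivative,
by integration in a single variable `x^i`.

Operators acting on the first jet commute with `D^2` and `∂/∂v`, so `E^2 L = 0` is inherited by the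
`P_i`. This is encoded by `IsTransverse` and `IsStable`. A second application, in the other jet,
gives `L = ∑ D^1_i D^2_j B_ij`. Conversely, Euler operators annihilate total derivatives
(`eulerSide_tD`), and `D^1`, `D^2` commute.

Such double divergences are those of the matrix form: in `M Q` the diagonal blocks are antisymmetric
and drop out against commuting derivatives, while the two off-diagonal blocks contribute equally
(`half_sum_frakD`). -/

noncomputable section

namespace NonlocalJet

/-! ### Smooth dependence of integrals on parameters. -/

section ParametricIntegral

variable {E F : Type} [NormedAddCommGroup E] [NormedSpace ℝ E] [FiniteDimensional ℝ E]
  [NormedAddCommGroup F] [NormedSpace ℝ F]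

/-- Differentiation under the integral sign over `[0, 1]` for a `C^1` integrand. -/
theorem hasFDerivAt_parametric_integral {f : E × ℝ → F} (hf : ContDiff ℝ 1 f) (x : E) :
    HasFDerivAt (fun x => ∫ t in (0 : ℝ)..1, f (x, t))
      (∫ t in (0 : ℝ)..1, (fderiv ℝ f (x, t)).comp (ContinuousLinearMap.inl ℝ E ℝ)) x := by
  have hd : Continuous fun z : E × ℝ =>
      (fderiv ℝ f z).comp (ContinuousLinearMap.inl ℝ E ℝ) :=
    (hf.continuous_fderiv one_ne_zero).clm_comp continuous_const
  obtain ⟨C, hC⟩ := ((isCompact_closedBall x 1).prod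
    (isCompact_Icc (a := (0 : ℝ)) (b := 1))).exists_bound_of_continuousOn hd.continuousOn
  refine intervalIntegral.hasFDerivAt_integral_of_dominated_of_fderiv_le
    (F := fun x t => f (x, t)) (bound := fun _ => C)
    (F' := fun x t => (fderiv ℝ f (x, t)).comp (ContinuousLinearMap.inl ℝ E ℝ))
    (Metric.ball_mem_nhds x one_pos) ?_ ?_ ?_ ?_ ?_ ?_
  · exact Filter.Eventually.of_forall fun y =>
      (hf.continuous.comp (by fun_prop)).aestronglyMeasurable
  · exact (hf.continuous.comp (by fun_prop)).intervalIntegrable _ _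
  · exact (hd.comp (f := fun t : ℝ => (x, t)) (by fun_prop)).aestronglyMeasurable
  · refine Filter.Eventually.of_forall fun t ht y hy => hC (y, t) ⟨?_, ?_⟩
    · exact Metric.ball_subset_closedBall hy
    · rw [Set.uIoc_of_le zero_le_one] at ht
      exact Set.Ioc_subset_Icc_self ht
  · exact intervalIntegrable_const
  · refine Filter.Eventually.of_forall fun t _ y _ => ?_
    exact ((hf.differentiable one_ne_zero) (y, t)).hasFDerivAt.comp y
      (hasFDerivAt_prodMk_left y t)

/-- The derivative is again a parametric integral, with values in continuous linear maps. The target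
space therefore has to vary in the induction. -/
theorem contDiff_nat_parametric_integral (n : ℕ) : ∀ {F : Type} [NormedAddCommGroup F]
    [NormedSpace ℝ F] [CompleteSpace F] {f : E × ℝ → F}, ContDiff ℝ ∞ f →
    ContDiff ℝ n (fun x => ∫ t in (0 : ℝ)..1, f (x, t)) := by
  induction n with
  | zero =>
    intro F _ _ _ f hf
    exact contDiff_zero.2 (continuous_iff_continuousAt.2 fun x =>
      (hasFDerivAt_parametric_integral (hf.of_le (by norm_cast)) x).continuousAt)
  | succ n ih =>
    intro F _ _ _ f hf
    have hd := hasFDerivAt_parametric_integral (hf.of_le (m := 1) (by norm_cast))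
    push_cast
    refine contDiff_succ_iff_hasFDerivAt.2 ⟨_, ?_, hd⟩
    exact ih (f := fun z => (fderiv ℝ f z).comp (ContinuousLinearMap.inl ℝ E ℝ))
      ((hf.fderiv_right (m := ∞) (by norm_cast)).clm_comp contDiff_const)

/-- Integrals over `[0, 1]` depend smoothly on parameters. -/
theorem contDiff_parametric_integral [CompleteSpace F] {f : E × ℝ → F} (hf : ContDiff ℝ ∞ f) :
    ContDiff ℝ ∞ (fun x => ∫ t in (0 : ℝ)..1, f (x, t)) :=
  contDiff_infty.2 fun n => contDiff_nat_parametric_integral n hf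

end ParametricIntegral

/-! ### The algebra of smooth functions of finite order. -/

variable {p q : ℕ}

/-- The space of pairs of jets of all orders. -/
abbrev BiJet (p q : ℕ) : Type := InfJet p q × InfJet p q

/-- Truncation at order `k`, as a linear map. -/
def truncL (p q k : ℕ) : InfJet p q →ₗ[ℝ] Jet p q k where
  toFun := truncate p q k
  map_add' _ _ := rfl
  map_smul' _ _ := rfl

/-- Truncation of both jets at order `k`. -/
def trunc (p q k : ℕ) : BiJet p q →ₗ[ℝ] Jet p q k × Jet p q k :=
  (truncL p q k).prodMap (truncL p q k)

/-- Extension of a jet of order `k` by zero. -/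
def extendL (p q k : ℕ) : Jet p q k →ₗ[ℝ] InfJet p q where
  toFun a := (a.1, fun c => if h : ∑ i, c.2 i ≤ k then a.2 (c.1, ⟨c.2, h⟩) else 0)
  map_add' a b := by
    ext c
    · rfl
    · by_cases h : ∑ i, c.2 i ≤ k <;> simp [h]
  map_smul' r a := by
    ext c
    · rfl
    · by_cases h : ∑ i, c.2 i ≤ k <;> simp [h]

/-- Extension of a pair of jets of order `k` by zero. -/
def extend (p q k : ℕ) : Jet p q k × Jet p q k →ₗ[ℝ] BiJet p q :=
  (extendL p q k).prodMap (extendL p q k)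

theorem truncL_extendL {k l : ℕ} (h : k ≤ l) (z : InfJet p q) :
    truncL p q k (extendL p q l (truncL p q l z)) = truncL p q k z := by
  ext c
  · rfl
  · have : ∑ i, c.2.1 i ≤ l := c.2.2.trans h
    exact dif_pos this

theorem trunc_extend {k l : ℕ} (h : k ≤ l) (z : BiJet p q) :
    trunc p q k (extend p q l (trunc p q l z)) = trunc p q k z :=
  Prod.ext (truncL_extendL h z.1) (truncL_extendL h z.2)

theorem contDiff_linearMap {V W : Type*} [NormedAddCommGroup V] [NormedSpace ℝ V]
    [FiniteDimensional ℝ V] [NormedAddCommGroup W] [NormedSpace ℝ W] (T : V →ₗ[ℝ] W)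
    {n : WithTop ℕ∞} : ContDiff ℝ n T :=
  T.toContinuousLinearMap.contDiff

theorem isSmooth_of_trunc {F : BiJet p q → ℝ} (k : ℕ) (f : Jet p q k × Jet p q k → ℝ)
    (hf : ContDiff ℝ ∞ f) (h : ∀ z, F z = f (trunc p q k z)) : IsSmooth F :=
  ⟨k, k, f, hf, funext h⟩

/-- A representative is pulled back along extension by zero, so every sufficiently large order
works, the same in both jets. Two functions can then share an order. -/
theorem IsSmooth.exists_trunc {F : BiJet p q → ℝ} (hF : IsSmooth F) :
    ∃ k, ∀ l, k ≤ l → ∃ f : Jet p q l × Jet p q l → ℝ, ContDiff ℝ ∞ f ∧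
      ∀ z, F z = f (trunc p q l z) := by
  obtain ⟨k₁, k₂, f, hf, rfl⟩ := hF
  refine ⟨max k₁ k₂, fun l hl => ?_⟩
  refine ⟨fun ζ => f (((truncL p q k₁).prodMap (truncL p q k₂) ∘ₗ extend p q l) ζ),
    hf.comp (contDiff_linearMap _), fun z => ?_⟩
  refine congrArg f (Prod.ext ?_ ?_)
  · exact (truncL_extendL ((le_max_left _ _).trans hl) z.1).symm
  · exact (truncL_extendL ((le_max_right _ _).trans hl) z.2).symm

theorem IsSmooth.exists_trunc₂ {F G : BiJet p q → ℝ} (hF : IsSmooth F) (hG : IsSmooth G) :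
    ∃ (k : ℕ) (f g : Jet p q k × Jet p q k → ℝ), ContDiff ℝ ∞ f ∧ ContDiff ℝ ∞ g ∧
      (∀ z, F z = f (trunc p q k z)) ∧ ∀ z, G z = g (trunc p q k z) := by
  obtain ⟨k, hk⟩ := hF.exists_trunc
  obtain ⟨l, hl⟩ := hG.exists_trunc
  obtain ⟨f, hf, hf'⟩ := hk _ (le_max_left k l)
  obtain ⟨g, hg, hg'⟩ := hl _ (le_max_right k l)
  exact ⟨_, f, g, hf, hg, hf', hg'⟩

theorem IsSmooth.add {F G : BiJet p q → ℝ} (hF : IsSmooth F) (hG : IsSmooth G) :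
    IsSmooth (F + G) := by
  obtain ⟨k, f, g, hf, hg, hf', hg'⟩ := hF.exists_trunc₂ hG
  exact isSmooth_of_trunc k (f + g) (hf.add hg) fun z => by simp [hf', hg']

theorem IsSmooth.mul {F G : BiJet p q → ℝ} (hF : IsSmooth F) (hG : IsSmooth G) :
    IsSmooth (F * G) := by
  obtain ⟨k, f, g, hf, hg, hf', hg'⟩ := hF.exists_trunc₂ hG
  exact isSmooth_of_trunc k (f * g) (hf.mul hg) fun z => by simp [hf', hg']

theorem isSmooth_const (r : ℝ) : IsSmooth (fun _ : BiJet p q => r) :=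
  isSmooth_of_trunc 0 (fun _ => r) contDiff_const fun _ => rfl

/-- The algebra of smooth functions of finite order. -/
def smoothAlgebra (p q : ℕ) : Subalgebra ℝ (BiJet p q → ℝ) where
  carrier := {F | IsSmooth F}
  add_mem' := IsSmooth.add
  mul_mem' := IsSmooth.mul
  algebraMap_mem' := isSmooth_const

/-! ### Derivations along affine vector fields on the infinite jets. -/

/-- Linear maps that lower the order of a truncation by at most one. -/
def IsLocal (T : BiJet p q →ₗ[ℝ] BiJet p q) : Prop :=
  ∀ k z, trunc p q (k + 1) z = 0 → trunc p q k (T z) = 0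

/-- To order `k`, `T z` is a linear function of a finite-dimensional truncation of `z`, hence
smooth; the space of infinite jets itself needs no calculus. -/
theorem IsLocal.trunc_extend {T : BiJet p q →ₗ[ℝ] BiJet p q} (hT : IsLocal T) (k : ℕ)
    (z : BiJet p q) :
    trunc p q k (T (extend p q (k + 1) (trunc p q (k + 1) z))) = trunc p q k (T z) := by
  have := hT k (z - extend p q (k + 1) (trunc p q (k + 1) z))
    (by rw [map_sub, NonlocalJet.trunc_extend le_rfl, sub_self])
  rw [map_sub, map_sub, sub_eq_zero] at this
  exact this.symm

theorem isLocal_zero : IsLocal (0 : BiJet p q →ₗ[ℝ] BiJet p q) := fun _ _ _ => by simp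

/-- The derivative of a function of finite order through its representative. -/
theorem hasLineDerivAt_of_trunc {W : Type*} [NormedAddCommGroup W] [NormedSpace ℝ W]
    {F : BiJet p q → W} {k : ℕ} {f : Jet p q k × Jet p q k → W}
    (h : ∀ z, F z = f (trunc p q k z)) {z : BiJet p q}
    (hf : DifferentiableAt ℝ f (trunc p q k z)) (v : BiJet p q) :
    HasLineDerivAt ℝ F (fderiv ℝ f (trunc p q k z) (trunc p q k v)) z v := by
  have := hf.hasFDerivAt.hasLineDerivAt (trunc p q k v)
  unfold HasLineDerivAt at this ⊢
  simpa [h] using this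

theorem lineDeriv_of_trunc {F : BiJet p q → ℝ} {k : ℕ} {f : Jet p q k × Jet p q k → ℝ}
    (h : ∀ z, F z = f (trunc p q k z)) (hf : ContDiff ℝ ∞ f) (z v : BiJet p q) :
    lineDeriv ℝ F z v = fderiv ℝ f (trunc p q k z) (trunc p q k v) :=
  (hasLineDerivAt_of_trunc h (hf.differentiable (by simp) _) v).lineDeriv

/-- The differential of a smooth function at a point. -/
def differential (F : smoothAlgebra p q) (z : BiJet p q) : BiJet p q →ₗ[ℝ] ℝ where
  toFun v := lineDeriv ℝ F.1 z v
  map_add' v w := by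
    -- Line derivatives need not be additive in the direction; here they are values of a Fréchet
    -- derivative of a representative.
    obtain ⟨k, hk⟩ := F.2.exists_trunc
    obtain ⟨f, hf, h⟩ := hk k le_rfl
    simp [lineDeriv_of_trunc h hf]
  map_smul' r v := by
    obtain ⟨k, hk⟩ := F.2.exists_trunc
    obtain ⟨f, hf, h⟩ := hk k le_rfl
    simp [lineDeriv_of_trunc h hf]

theorem hasLineDerivAt_differential (F : smoothAlgebra p q) (z v : BiJet p q) :
    HasLineDerivAt ℝ F.1 (differential F z v) z v := by
  obtain ⟨k, hk⟩ := F.2.exists_trunc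
  obtain ⟨f, hf, h⟩ := hk k le_rfl
  exact (hasLineDerivAt_of_trunc h (hf.differentiable (by simp) _) v).lineDifferentiableAt.hasLineDerivAt

theorem differential_add (F G : smoothAlgebra p q) (z v : BiJet p q) :
    differential (F + G) z v = differential F z v + differential G z v :=
  (HasDerivAt.add (hasLineDerivAt_differential F z v) (hasLineDerivAt_differential G z v)).deriv

theorem differential_mul (F G : smoothAlgebra p q) (z v : BiJet p q) :
    differential (F * G) z v = differential F z v * G.1 z + F.1 z * differential G z v := by
  have := HasDerivAt.mul (hasLineDerivAt_differential F z v) (hasLineDerivAt_differential G z v)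
  rw [zero_smul, add_zero] at this
  exact this.deriv

theorem differential_smul (r : ℝ) (F : smoothAlgebra p q) (z v : BiJet p q) :
    differential (r • F) z v = r * differential F z v :=
  (HasDerivAt.const_mul r (hasLineDerivAt_differential F z v)).deriv

theorem isSmooth_differential (F : smoothAlgebra p q) (a : BiJet p q)
    {S : BiJet p q →ₗ[ℝ] BiJet p q} (hS : IsLocal S) :
    IsSmooth (fun z => differential F z (a + S z)) := by
  obtain ⟨k, hk⟩ := F.2.exists_trunc
  obtain ⟨f, hf, h⟩ := hk k le_rfl
  refine isSmooth_of_trunc (k + 1) (fun ζ =>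
    fderiv ℝ f ((trunc p q k ∘ₗ extend p q (k + 1)) ζ)
      (trunc p q k a + (trunc p q k ∘ₗ S ∘ₗ extend p q (k + 1)) ζ)) ?_ fun z => ?_
  · refine ContDiff.clm_apply ?_ (contDiff_const.add (contDiff_linearMap _))
    exact (hf.fderiv_right (m := ∞) (by norm_cast)).comp (contDiff_linearMap _)
  · simp only [LinearMap.comp_apply, hS.trunc_extend, trunc_extend k.le_succ, ← map_add]
    exact lineDeriv_of_trunc h hf _ _

/-- The derivation `F ↦ dF(a + S z)` along an affine vector field. -/
def lie (a : BiJet p q) (S : BiJet p q →ₗ[ℝ] BiJet p q) (hS : IsLocal S) :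
    Module.End ℝ (smoothAlgebra p q) where
  toFun F := ⟨fun z => differential F z (a + S z), isSmooth_differential F a hS⟩
  map_add' F G := Subtype.ext <| funext fun z => differential_add F G z _
  map_smul' r F := Subtype.ext <| funext fun z => differential_smul r F z _

theorem lie_apply (a : BiJet p q) {S : BiJet p q →ₗ[ℝ] BiJet p q} (hS : IsLocal S)
    (F : smoothAlgebra p q) (z : BiJet p q) : (lie a S hS F).1 z = differential F z (a + S z) :=
  rfl

theorem lie_mul (a : BiJet p q) {S : BiJet p q →ₗ[ℝ] BiJet p q} (hS : IsLocal S)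
    (F G : smoothAlgebra p q) : lie a S hS (F * G) = lie a S hS F * G + F * lie a S hS G :=
  Subtype.ext <| funext fun z => differential_mul F G z _

/-- The commutator of two derivations along affine vector fields. -/
theorem lie_lie_sub (a b : BiJet p q) {S R : BiJet p q →ₗ[ℝ] BiJet p q} (hS : IsLocal S)
    (hR : IsLocal R) (F : smoothAlgebra p q) (z : BiJet p q) :
    (lie a S hS (lie b R hR F)).1 z - (lie b R hR (lie a S hS F)).1 z =
      differential F z (R (a + S z) - S (b + R z)) := by
  obtain ⟨k, hk⟩ := F.2.exists_trunc
  obtain ⟨f, hf, h⟩ := hk k le_rfl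
  -- Product rule: a Hessian term plus the derivative of the field's coefficients. In the commutator
  -- the Hessian terms cancel by symmetry.
  have key : ∀ (b : BiJet p q) (R : BiJet p q →ₗ[ℝ] BiJet p q) (hR : IsLocal R) (v : BiJet p q),
      differential (lie b R hR F) z v =
        fderiv ℝ (fderiv ℝ f) (trunc p q k z) (trunc p q k v) (trunc p q k (b + R z)) +
          differential F z (R v) := by
    intro b R hR v
    have h₁ := hasLineDerivAt_of_trunc (F := fun z => fderiv ℝ f (trunc p q k z))
      (f := fderiv ℝ f) (fun _ => rfl) (z := z)
      ((hf.fderiv_right (m := ∞) (by norm_cast)).differentiable (by simp) _) v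
    have h₂ : HasDerivAt (fun t : ℝ => trunc p q k (b + R (z + t • v)))
        (trunc p q k (R v)) 0 := by
      simp only [map_add, map_smul, ← add_assoc]
      simpa using ((hasDerivAt_id (0 : ℝ)).smul_const (trunc p q k (R v))).const_add
        (trunc p q k b + trunc p q k (R z))
    have h₃ := (HasDerivAt.clm_apply h₁ h₂).deriv
    simp only [zero_smul, add_zero] at h₃
    change lineDeriv ℝ (fun z => differential F z (b + R z)) z v = _
    have h₄ : (fun z => differential F z (b + R z)) =
        fun z => fderiv ℝ f (trunc p q k z) (trunc p q k (b + R z)) :=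
      funext fun z => lineDeriv_of_trunc h hf _ _
    rw [h₄]
    refine h₃.trans (congrArg _ ?_)
    exact (lineDeriv_of_trunc h hf _ _).symm
  rw [lie_apply, lie_apply, key, key, map_sub,
    (hf.contDiffAt.isSymmSndFDerivAt
    (by rw [minSmoothness_of_isRCLikeNormedField]; norm_cast)).eq]
  abel

/-- The hypothesis says that the Lie bracket of the two affine fields vanishes. -/
theorem commute_lie {a b : BiJet p q} {S R : BiJet p q →ₗ[ℝ] BiJet p q} (hS : IsLocal S)
    (hR : IsLocal R) (h : ∀ z, R (a + S z) = S (b + R z)) :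
    Commute (lie a S hS) (lie b R hR) := by
  refine LinearMap.ext fun F => Subtype.ext <| funext fun z => ?_
  have := lie_lie_sub a b hS hR F z
  rw [h, sub_self, map_zero, sub_eq_zero] at this
  exact this

/-! ### Averaging along segments. -/

theorem isSmooth_integral (F : smoothAlgebra p q) {T₀ T₁ : BiJet p q →ₗ[ℝ] BiJet p q}
    (h₀ : IsLocal T₀) (h₁ : IsLocal T₁) :
    IsSmooth (fun z => ∫ t in (0 : ℝ)..1, F.1 (T₀ z + t • T₁ z)) := by
  obtain ⟨k, hk⟩ := F.2.exists_trunc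
  obtain ⟨f, hf, h⟩ := hk k le_rfl
  refine isSmooth_of_trunc (k + 1) (fun ζ => ∫ t in (0 : ℝ)..1,
    f ((trunc p q k ∘ₗ T₀ ∘ₗ extend p q (k + 1)) ζ +
      t • (trunc p q k ∘ₗ T₁ ∘ₗ extend p q (k + 1)) ζ)) ?_ fun z => ?_
  · refine contDiff_parametric_integral (f := fun ζ : (Jet p q (k + 1) × Jet p q (k + 1)) × ℝ =>
      f ((trunc p q k ∘ₗ T₀ ∘ₗ extend p q (k + 1)) ζ.1 +
        ζ.2 • (trunc p q k ∘ₗ T₁ ∘ₗ extend p q (k + 1)) ζ.1)) ?_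
    exact hf.comp (((contDiff_linearMap _).comp contDiff_fst).add
      (contDiff_snd.smul ((contDiff_linearMap _).comp contDiff_fst)))
  · simp only [LinearMap.comp_apply, h₀.trunc_extend, h₁.trunc_extend, ← map_add, ← map_smul, h]

theorem continuous_comp_segment (F : smoothAlgebra p q) (a b : BiJet p q) :
    Continuous fun t : ℝ => F.1 (a + t • b) := by
  obtain ⟨k, hk⟩ := F.2.exists_trunc
  obtain ⟨f, hf, h⟩ := hk k le_rfl
  simp only [h, map_add, map_smul]
  exact hf.continuous.comp (by fun_prop)

theorem continuous_differential_segment (F : smoothAlgebra p q) (a b v : BiJet p q) :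
    Continuous fun t : ℝ => differential F (a + t • b) v := by
  obtain ⟨k, hk⟩ := F.2.exists_trunc
  obtain ⟨f, hf, h⟩ := hk k le_rfl
  have h' : ∀ z v, differential F z v = _ := lineDeriv_of_trunc h hf
  simp only [h', map_add, map_smul]
  exact ((hf.continuous_fderiv (by simp)).comp (by fun_prop)).clm_apply continuous_const

theorem hasDerivAt_comp_segment (F : smoothAlgebra p q) (a b : BiJet p q) (t : ℝ) :
    HasDerivAt (fun t : ℝ => F.1 (a + t • b)) (differential F (a + t • b) b) t := by
  have h : HasDerivAt (fun s : ℝ => F.1 (a + t • b + s • b)) (differential F (a + t • b) b)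
    (t - t) := by
    rw [sub_self]
    exact hasLineDerivAt_differential F (a + t • b) b
  have h' := HasDerivAt.comp (h₂ := fun s : ℝ => F.1 (a + t • b + s • b)) (h := fun s => s - t)
    t h ((hasDerivAt_id' t).sub_const t)
  rw [mul_one] at h'
  refine h'.congr_of_eventuallyEq (Filter.Eventually.of_forall fun s => ?_)
  simp only [Function.comp, add_assoc, ← add_smul]
  rw [add_sub_cancel]

/-- Averaging over the segment from `T₀ z` to `T₀ z + T₁ z`. -/
def average (T₀ T₁ : BiJet p q →ₗ[ℝ] BiJet p q) (h₀ : IsLocal T₀) (h₁ : IsLocal T₁) :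
    Module.End ℝ (smoothAlgebra p q) where
  toFun F := ⟨fun z => ∫ t in (0 : ℝ)..1, F.1 (T₀ z + t • T₁ z), isSmooth_integral F h₀ h₁⟩
  map_add' F G := Subtype.ext <| funext fun _ => intervalIntegral.integral_add
    ((continuous_comp_segment F _ _).intervalIntegrable _ _)
    ((continuous_comp_segment G _ _).intervalIntegrable _ _)
  map_smul' _ _ := Subtype.ext <| funext fun _ => intervalIntegral.integral_const_mul _ _

theorem average_apply {T₀ T₁ : BiJet p q →ₗ[ℝ] BiJet p q} (h₀ : IsLocal T₀) (h₁ : IsLocal T₁)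
    (F : smoothAlgebra p q) (z : BiJet p q) :
    (average T₀ T₁ h₀ h₁ F).1 z = ∫ t in (0 : ℝ)..1, F.1 (T₀ z + t • T₁ z) :=
  rfl

theorem differential_average {T₀ T₁ : BiJet p q →ₗ[ℝ] BiJet p q} (h₀ : IsLocal T₀)
    (h₁ : IsLocal T₁) (F : smoothAlgebra p q) (z v : BiJet p q) :
    differential (average T₀ T₁ h₀ h₁ F) z v =
      ∫ t in (0 : ℝ)..1, differential F (T₀ z + t • T₁ z) (T₀ v + t • T₁ v) := by
  obtain ⟨k, hk⟩ := F.2.exists_trunc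
  obtain ⟨f, hf, h⟩ := hk k le_rfl
  set π := trunc p q k
  -- Only the line `z + s v` and the parameter `t` matter, so the problem is one of two real
  -- variables.
  let g : ℝ × ℝ → ℝ := fun c =>
    f ((π (T₀ z) + c.2 • π (T₁ z)) + c.1 • (π (T₀ v) + c.2 • π (T₁ v)))
  have hg : ContDiff ℝ ∞ g := hf.comp (by fun_prop)
  have h₃ := (hasFDerivAt_parametric_integral (hg.of_le (m := 1) (by norm_cast)) 0).hasDerivAt
  have h₄ : ∀ s : ℝ, (average T₀ T₁ h₀ h₁ F).1 (z + s • v) = ∫ t in (0 : ℝ)..1, g (s, t) := by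
    intro s
    rw [average_apply]
    refine intervalIntegral.integral_congr fun t _ => ?_
    simp only [h, g, map_add, map_smul]
    refine congrArg f ?_
    module
  change deriv (fun s : ℝ => (average T₀ T₁ h₀ h₁ F).1 (z + s • v)) 0 = _
  simp only [h₄]
  rw [h₃.deriv, ContinuousLinearMap.intervalIntegral_apply]
  · refine intervalIntegral.integral_congr fun t _ => ?_
    have h₅ : HasDerivAt (fun s : ℝ => g (s, t)) (fderiv ℝ g (0, t) (1, 0)) 0 := by
      have := ((hg.differentiable (by simp) (0, t)).hasFDerivAt.comp (0 : ℝ)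
        (hasFDerivAt_prodMk_left (0 : ℝ) t)).hasDerivAt
      exact this.congr_deriv (by simp)
    have h₆ := hasLineDerivAt_differential F (T₀ z + t • T₁ z) (T₀ v + t • T₁ v)
    refine (h₅.unique ?_)
    refine HasDerivAt.congr_of_eventuallyEq h₆ (Filter.Eventually.of_forall fun s => ?_)
    simp only [h, g, map_add, map_smul]
  · refine Continuous.intervalIntegrable ?_ _ _
    exact ((hg.continuous_fderiv (by simp)).comp (by fun_prop)).clm_comp continuous_const

/-- A derivation along a vector field invariant under all maps `T₀ + t T₁` commutes with
averaging. -/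
theorem commute_lie_average {a : BiJet p q} {S T₀ T₁ : BiJet p q →ₗ[ℝ] BiJet p q}
    (hS : IsLocal S) (h₀ : IsLocal T₀) (h₁ : IsLocal T₁) (ha₀ : T₀ a = a) (ha₁ : T₁ a = 0)
    (hc₀ : ∀ z, T₀ (S z) = S (T₀ z)) (hc₁ : ∀ z, T₁ (S z) = S (T₁ z)) :
    Commute (lie a S hS) (average T₀ T₁ h₀ h₁) := by
  refine LinearMap.ext fun F => Subtype.ext <| funext fun z => ?_
  change differential (average T₀ T₁ h₀ h₁ F) z (a + S z) = _
  rw [differential_average]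
  refine intervalIntegral.integral_congr fun t _ => ?_
  change _ = differential F (T₀ z + t • T₁ z) (a + S (T₀ z + t • T₁ z))
  refine congrArg (differential F (T₀ z + t • T₁ z)) ?_
  simp only [map_add, map_smul, ha₀, ha₁, hc₀, hc₁]
  module

/-! ### Total and partial derivatives in each jet, and their commutators. -/

/-- The inclusion of one of the two jet spaces. -/
def inj : Bool → InfJet p q →ₗ[ℝ] BiJet p q
  | false => LinearMap.inl ℝ _ _
  | true => LinearMap.inr ℝ _ _

/-- The projection to one of the two jet spaces. -/
def proj : Bool → BiJet p q →ₗ[ℝ] InfJet p q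
  | false => LinearMap.fst ℝ _ _
  | true => LinearMap.snd ℝ _ _

/-- Replacement of one of the two jets. -/
def put : Bool → BiJet p q → InfJet p q → BiJet p q
  | false, z, a => (a, z.2)
  | true, z, a => (z.1, a)

/-- A function of two jets as a function of one of them. -/
def slice (σ : Bool) (F : BiJet p q → ℝ) (z : BiJet p q) : InfJet p q → ℝ :=
  fun a => F (put σ z a)

theorem proj_inj (σ : Bool) (a : InfJet p q) : proj σ (inj σ a) = a := by cases σ <;> rfl

theorem proj_inj_of_ne {σ τ : Bool} (h : σ ≠ τ) (a : InfJet p q) : proj σ (inj τ a) = 0 := by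
  cases σ <;> cases τ <;> first | rfl | exact absurd rfl h

theorem put_proj (σ : Bool) (z : BiJet p q) : put σ z (proj σ z) = z := by cases σ <;> rfl

theorem proj_put (σ : Bool) (z : BiJet p q) (a : InfJet p q) : proj σ (put σ z a) = a := by
  cases σ <;> rfl

theorem put_add (σ : Bool) (z : BiJet p q) (a w : InfJet p q) :
    put σ z (a + w) = put σ z a + inj σ w := by
  cases σ
  · exact Prod.ext rfl (add_zero z.2).symm
  · exact Prod.ext (add_zero z.1).symm rfl

theorem trunc_inj (σ : Bool) {k : ℕ} {w : InfJet p q} (h : truncL p q k w = 0) :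
    trunc p q k (inj σ w) = 0 := by
  cases σ
  · exact Prod.ext h (map_zero (truncL p q k))
  · exact Prod.ext (map_zero (truncL p q k)) h

theorem truncL_proj (σ : Bool) {k : ℕ} {z : BiJet p q} (h : trunc p q k z = 0) :
    truncL p q k (proj σ z) = 0 := by
  cases σ
  · exact congrArg Prod.fst h
  · exact congrArg Prod.snd h

theorem truncL_eq_zero_iff {k : ℕ} {w : InfJet p q} : truncL p q k w = 0 ↔
    w.1 = 0 ∧ ∀ α J, ∑ i, J i ≤ k → w.2 (α, J) = 0 := by
  constructor
  · intro h
    exact ⟨congrArg Prod.fst h, fun α J hJ => congrFun (congrArg Prod.snd h) (α, ⟨J, hJ⟩)⟩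
  · rintro ⟨h₁, h₂⟩
    exact Prod.ext h₁ (funext fun c => h₂ c.1 c.2.1 c.2.2)

theorem sum_add_single (J : MultiIndex p) (i : Fin p) :
    ∑ j, (J + Pi.single i 1 : MultiIndex p) j = ∑ j, J j + 1 := by
  simp [Finset.sum_add_distrib]

/-- The linear part of the vector field of a total derivative. -/
def shiftL (i : Fin p) : InfJet p q →ₗ[ℝ] InfJet p q where
  toFun a := (0, fun c => a.2 (c.1, c.2 + Pi.single i 1))
  map_add' _ _ := Prod.ext (add_zero 0).symm rfl
  map_smul' r _ := Prod.ext (smul_zero r).symm rfl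

/-- `shiftL` on one of the two jets. -/
def shift (σ : Bool) (i : Fin p) : BiJet p q →ₗ[ℝ] BiJet p q := inj σ ∘ₗ shiftL i ∘ₗ proj σ

theorem isLocal_inj_comp_proj (σ : Bool) (T : InfJet p q →ₗ[ℝ] InfJet p q)
    (h : ∀ k w, truncL p q (k + 1) w = 0 → truncL p q k (T w) = 0) :
    IsLocal (inj σ ∘ₗ T ∘ₗ proj σ) := fun k _ hz =>
  trunc_inj σ (h k _ (truncL_proj σ hz))

theorem isLocal_shift (σ : Bool) (i : Fin p) :
    IsLocal (shift σ i : BiJet p q →ₗ[ℝ] BiJet p q) := by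
  refine isLocal_inj_comp_proj σ _ fun k w hw => ?_
  rw [truncL_eq_zero_iff] at hw ⊢
  exact ⟨rfl, fun α J hJ => hw.2 _ _ ((sum_add_single J i).trans_le (Nat.succ_le_succ hJ))⟩

/-- The total derivative `D_i` with respect to one of the two jets. -/
def tD (σ : Bool) (i : Fin p) : Module.End ℝ (smoothAlgebra p q) :=
  lie (inj σ (Pi.single i 1, 0)) (shift σ i) (isLocal_shift σ i)

/-- The partial derivative with respect to a jet coordinate. -/
def pU (σ : Bool) (α : Fin q) (J : MultiIndex p) : Module.End ℝ (smoothAlgebra p q) :=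
  lie (inj σ (0, Pi.single (α, J) 1)) 0 isLocal_zero

/-- The iterated total derivative. -/
def tDMulti (σ : Bool) (J : MultiIndex p) : Module.End ℝ (smoothAlgebra p q) :=
  ((List.finRange p).map fun i => tD σ i ^ J i).prod

/-- The Euler operator with respect to one of the two jets. -/
def eulerSide (σ : Bool) (α : Fin q) (F : smoothAlgebra p q) : smoothAlgebra p q :=
  ∑ᶠ J : MultiIndex p, (-1 : ℝ) ^ (∑ i, J i) • tDMulti σ J (pU σ α J F)

theorem shiftL_comm (i j : Fin p) (a : InfJet p q) :
    shiftL i (shiftL j a) = shiftL j (shiftL i a) := by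
  refine Prod.ext rfl (funext fun c => ?_)
  change a.2 (c.1, c.2 + Pi.single i 1 + Pi.single j 1) =
    a.2 (c.1, c.2 + Pi.single j 1 + Pi.single i 1)
  rw [add_right_comm]

theorem shiftL_base (i : Fin p) (a : Fin p → ℝ) : shiftL (q := q) i (a, 0) = 0 := rfl

theorem commute_tD (σ τ : Bool) (i j : Fin p) :
    Commute (tD σ i : Module.End ℝ (smoothAlgebra p q)) (tD τ j) := by
  refine commute_lie _ _ fun z => ?_
  by_cases h : σ = τ
  · subst h
    simp only [shift, LinearMap.comp_apply, map_add, proj_inj, shiftL_base, shiftL_comm i j]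
  · simp only [shift, LinearMap.comp_apply, map_add, proj_inj_of_ne h,
      proj_inj_of_ne (Ne.symm h), map_zero, add_zero]

theorem commute_tD_pU {σ τ : Bool} (h : σ ≠ τ) (i : Fin p) (α : Fin q) (J : MultiIndex p) :
    Commute (tD σ i) (pU τ α J) := by
  refine commute_lie _ _ fun z => ?_
  simp only [shift, LinearMap.comp_apply, map_add, proj_inj_of_ne h, map_zero, add_zero,
    LinearMap.zero_apply]

theorem commute_pU (σ τ : Bool) (α β : Fin q) (J K : MultiIndex p) :
    Commute (pU σ α J) (pU τ β K) :=
  commute_lie _ _ fun z => by simp only [LinearMap.zero_apply]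

/-- The coordinate field is constant and `D_i` is affine, so their bracket is the shift of a basis
vector: another basis vector if `i` occurs in `J`, zero otherwise. The next two lemmas are these
cases. -/
theorem pU_tD_sub (σ : Bool) (α : Fin q) (J : MultiIndex p) (i : Fin p) (F : smoothAlgebra p q)
    (z : BiJet p q) : (pU σ α J (tD σ i F)).1 z - (tD σ i (pU σ α J F)).1 z =
      differential F z (inj σ (shiftL i (0, Pi.single (α, J) 1))) := by
  refine (lie_lie_sub _ _ _ _ F z).trans ?_
  simp only [shift, LinearMap.zero_apply, add_zero, sub_zero, LinearMap.comp_apply, proj_inj]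

theorem pU_add_single_tD (σ : Bool) (α : Fin q) (K : MultiIndex p) (i : Fin p)
    (F : smoothAlgebra p q) : pU σ α (K + Pi.single i 1) (tD σ i F) =
      tD σ i (pU σ α (K + Pi.single i 1) F) + pU σ α K F := by
  refine Subtype.ext (funext fun z => ?_)
  refine (sub_eq_iff_eq_add'.1 (pU_tD_sub σ α (K + Pi.single i 1) i F z)).trans ?_
  refine congrArg _ (congrArg (differential F z) ?_)
  rw [LinearMap.zero_apply, add_zero]
  refine congrArg (inj σ) (Prod.ext rfl (funext fun c => ?_))
  change Pi.single (M := fun _ => ℝ) (α, K + Pi.single i 1) 1 (c.1, c.2 + Pi.single i 1) =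
    Pi.single (M := fun _ => ℝ) (α, K) 1 c
  simp [Pi.single_apply, Prod.ext_iff]

theorem pU_tD_of_eq_zero (σ : Bool) (α : Fin q) {J : MultiIndex p} {i : Fin p} (hJ : J i = 0)
    (F : smoothAlgebra p q) : pU σ α J (tD σ i F) = tD σ i (pU σ α J F) := by
  refine Subtype.ext (funext fun z => sub_eq_zero.1 ?_)
  have h : shiftL i ((0, Pi.single (α, J) 1) : InfJet p q) = 0 :=
    Prod.ext rfl <| funext fun c => Pi.single_eq_of_ne (fun h => by
      have := congrFun (congrArg Prod.snd h) i
      simp [hJ] at this) _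
  rw [pU_tD_sub, h, map_zero, map_zero]

/-- The multi-indices up to the order of `F` serve for all points and both jets at once; this makes
every formal sum over multi-indices finite. -/
theorem exists_finset_differential (F : smoothAlgebra p q) : ∃ s : Finset (MultiIndex p),
    ∀ (σ : Bool) (z : BiJet p q) (b : Fin q × MultiIndex p → ℝ),
      (∀ α, ∀ J ∈ s, b (α, J) = 0) → differential F z (inj σ (0, b)) = 0 := by
  obtain ⟨k, hk⟩ := F.2.exists_trunc
  obtain ⟨f, hf, h⟩ := hk k le_rfl
  refine ⟨Finset.univ.image (Subtype.val : MultiIndexLE p k → _), fun σ z b hb => ?_⟩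
  have : trunc p q k (inj σ (0, b)) = 0 :=
    trunc_inj σ (truncL_eq_zero_iff.2 ⟨rfl, fun α J hJ => hb α J (by simpa using hJ)⟩)
  exact (lineDeriv_of_trunc h hf z _).trans (by rw [this, map_zero])

theorem pU_eq_zero {F : smoothAlgebra p q} {s : Finset (MultiIndex p)} {σ : Bool}
    (hs : ∀ (z : BiJet p q) (b : Fin q × MultiIndex p → ℝ),
      (∀ α, ∀ J ∈ s, b (α, J) = 0) → differential F z (inj σ (0, b)) = 0)
    (α : Fin q) {J : MultiIndex p} (hJ : J ∉ s) : pU σ α J F = 0 := by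
  refine Subtype.ext (funext fun z => ?_)
  change differential F z (_ + 0) = 0
  rw [add_zero]
  refine hs z _ fun β K hK => Pi.single_eq_of_ne (fun h => hJ ?_) _
  obtain rfl : K = J := congrArg Prod.snd h
  exact hK

theorem differential_fiber (F : smoothAlgebra p q) {s : Finset (MultiIndex p)} (σ : Bool)
    (z : BiJet p q)
    (hs : ∀ b : Fin q × MultiIndex p → ℝ,
      (∀ α, ∀ J ∈ s, b (α, J) = 0) → differential F z (inj σ (0, b)) = 0)
    (b : Fin q × MultiIndex p → ℝ) :
    differential F z (inj σ (0, b)) = ∑ α, ∑ J ∈ s, b (α, J) * (pU σ α J F).1 z := by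
  let ℓ := differential F z ∘ₗ inj σ ∘ₗ LinearMap.inr ℝ _ _
  -- Subtracting the finite part of `b` on `s` leaves a vector that the differential does not see.
  have h₁ : ℓ (b - ∑ c ∈ Finset.univ ×ˢ s, b c • Pi.single c 1) = 0 := by
    refine hs _ fun α J hJ => ?_
    change b (α, J) - (∑ c ∈ Finset.univ ×ˢ s, b c • Pi.single (M := fun _ => ℝ) c 1) (α, J) = 0
    rw [Finset.sum_apply, Finset.sum_eq_single (α, J)]
    · simp
    · intro c _ hc
      simp [Pi.single_eq_of_ne (Ne.symm hc)]
    · intro h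
      exact absurd (Finset.mem_product.2 ⟨Finset.mem_univ _, hJ⟩) h
  rw [map_sub, sub_eq_zero, map_sum, Finset.sum_product] at h₁
  refine h₁.trans (Finset.sum_congr rfl fun α _ => Finset.sum_congr rfl fun J _ => ?_)
  rw [map_smul, smul_eq_mul]
  refine congrArg _ (congrArg (differential F z) (add_zero _).symm)

/-! ### Agreement with the operators of the statement. -/

theorem lineDeriv_slice (σ : Bool) (F : smoothAlgebra p q) (z : BiJet p q) (a w : InfJet p q) :
    lineDeriv ℝ (slice σ F.1 z) a w = differential F (put σ z a) (inj σ w) := by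
  change _ = lineDeriv ℝ F.1 _ _
  simp only [lineDeriv, slice, put_add, map_smul]

theorem slice_pU (σ : Bool) (α : Fin q) (J : MultiIndex p) (F : smoothAlgebra p q)
    (z : BiJet p q) : slice σ (pU σ α J F).1 z = partialU α J (slice σ F.1 z) := by
  funext a
  refine Eq.trans ?_ (lineDeriv_slice σ F z a _).symm
  exact congrArg (differential F (put σ z a)) (add_zero _)

theorem slice_tD (σ : Bool) (i : Fin p) (F : smoothAlgebra p q) (z : BiJet p q) :
    slice σ (tD σ i F).1 z = totalDeriv i (slice σ F.1 z) := by
  funext a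
  obtain ⟨s, hs⟩ := exists_finset_differential F
  change differential F (put σ z a) (_ + _) = _
  rw [map_add, shift, LinearMap.comp_apply, LinearMap.comp_apply, proj_put]
  refine congrArg₂ (· + ·) (lineDeriv_slice σ F z a _).symm ?_
  refine (differential_fiber F σ _ (hs σ _) _).trans (Finset.sum_congr rfl fun α _ => ?_)
  rw [finsum_eq_sum_of_support_subset (s := s)]
  · refine Finset.sum_congr rfl fun J _ => congrArg _ ?_
    exact congrFun (slice_pU σ α J F z) a
  · intro J hJ
    by_contra h
    refine hJ (mul_eq_zero_of_right _ ?_)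
    rw [partialU, lineDeriv_slice]
    refine hs σ _ _ fun β K hK => Pi.single_eq_of_ne (fun h' => h ?_) _
    obtain rfl : K = J := congrArg Prod.snd h'
    exact hK

theorem slice_tD_pow (σ : Bool) (i : Fin p) (n : ℕ) (F : smoothAlgebra p q) (z : BiJet p q) :
    slice σ ((tD σ i ^ n) F).1 z = (totalDeriv i)^[n] (slice σ F.1 z) := by
  induction n with
  | zero => rfl
  | succ n ih =>
    rw [pow_succ', Module.End.mul_apply, slice_tD, ih, Function.iterate_succ_apply']

theorem slice_tDMulti (σ : Bool) (J : MultiIndex p) (F : smoothAlgebra p q) (z : BiJet p q) :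
    slice σ (tDMulti σ J F).1 z = totalDerivMulti J (slice σ F.1 z) := by
  unfold tDMulti totalDerivMulti
  induction List.finRange p with
  | nil => rfl
  | cons i l ih =>
    rw [List.map_cons, List.prod_cons, Module.End.mul_apply, slice_tD_pow, ih, List.foldr_cons]

theorem finite_support_eulerSide (σ : Bool) (α : Fin q) (F : smoothAlgebra p q) :
    (Function.support fun J : MultiIndex p =>
      (-1 : ℝ) ^ (∑ i, J i) • tDMulti σ J (pU σ α J F)).Finite := by
  obtain ⟨s, hs⟩ := exists_finset_differential F
  refine s.finite_toSet.subset fun J hJ => ?_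
  by_contra h
  exact hJ (by simp only [pU_eq_zero (hs σ) α h, map_zero, smul_zero])

theorem eulerSide_apply (σ : Bool) (α : Fin q) (F : smoothAlgebra p q) (z : BiJet p q) :
    (eulerSide σ α F).1 z = euler α (slice σ F.1 z) (proj σ z) := by
  let ev : smoothAlgebra p q →+ ℝ :=
    (Pi.evalAddMonoidHom _ z).comp (smoothAlgebra p q).val.toAddMonoidHom
  refine (ev.map_finsum (finite_support_eulerSide σ α F)).trans (finsum_congr fun J => ?_)
  refine congrArg ((-1 : ℝ) ^ (∑ i, J i) * ·) ?_
  rw [← slice_pU, ← slice_tDMulti, slice, put_proj]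

theorem tD_apply (σ : Bool) (i : Fin p) (F : smoothAlgebra p q) (z : BiJet p q) :
    (tD σ i F).1 z = totalDeriv i (slice σ F.1 z) (proj σ z) := by
  rw [← slice_tD, slice, put_proj]

/-! ### Euler operators annihilate total derivatives. -/

theorem commute_tDMulti {T : Module.End ℝ (smoothAlgebra p q)} {σ : Bool}
    (h : ∀ i, Commute T (tD σ i)) (J : MultiIndex p) : Commute T (tDMulti σ J) :=
  Commute.list_prod_right _ _ fun _ hx => by
    obtain ⟨i, _, rfl⟩ := List.mem_map.1 hx
    exact (h i).pow_right _

theorem list_prod_pow_add_single {M ι : Type*} [Monoid M] [DecidableEq ι] (A : ι → M)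
    (hA : ∀ i j, Commute (A i) (A j)) (J : ι → ℕ) (i : ι) : ∀ l : List ι, l.Nodup →
    (l.map fun j => A j ^ (J + Pi.single i 1 : ι → ℕ) j).prod =
      (l.map fun j => A j ^ J j).prod * if i ∈ l then A i else 1
  | [], _ => by simp
  | j :: l, hl => by
    rw [List.nodup_cons] at hl
    rw [List.map_cons, List.prod_cons, list_prod_pow_add_single A hA J i l hl.2, List.map_cons,
      List.prod_cons]
    by_cases h : i = j
    · subst h
      have hc : Commute (A i) (l.map fun j => A j ^ J j).prod :=
        Commute.list_prod_right _ _ fun _ hx => by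
          obtain ⟨j, _, rfl⟩ := List.mem_map.1 hx
          exact (hA i j).pow_right _
      simp only [hl.1, if_false, mul_one, List.mem_cons, true_or, if_true, Pi.add_apply,
        Pi.single_eq_same, pow_succ]
      rw [mul_assoc, hc.eq, mul_assoc]
    · simp [h, mul_assoc]

theorem tDMulti_add_single (σ : Bool) (J : MultiIndex p) (i : Fin p) :
    (tDMulti σ (J + Pi.single i 1) : Module.End ℝ (smoothAlgebra p q)) =
      tDMulti σ J * tD σ i := by
  have := list_prod_pow_add_single (tD σ : Fin p → Module.End ℝ (smoothAlgebra p q))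
    (commute_tD σ σ) J i (List.finRange p) (List.nodup_finRange p)
  rwa [if_pos (List.mem_finRange i)] at this

theorem tDMulti_zero (σ : Bool) :
    (tDMulti σ 0 : Module.End ℝ (smoothAlgebra p q)) = 1 := by
  simp [tDMulti]

theorem exists_eq_add_single {J : MultiIndex p} {i : Fin p} (h : J i ≠ 0) :
    ∃ K : MultiIndex p, J = K + Pi.single i 1 := by
  refine ⟨J - Pi.single i 1, (tsub_add_cancel_of_le fun j => ?_).symm⟩
  by_cases hj : j = i
  · subst hj
    simpa using Nat.one_le_iff_ne_zero.2 h
  · simp [Pi.single_eq_of_ne hj]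

/-- Let `b_J` be the terms of the Euler sum and `a_J` the same with `D_i` moved in front of
`∂/∂u^α_J`. The commutator gives `a_J - b_J = a_K` for `J = K + i`, and `0` if `i` does not occur in
`J`. Hence `∑ (a_J - b_J) = ∑ a_J`, that is, `∑ b_J = 0`. -/
theorem eulerSide_tD (σ : Bool) (α : Fin q) (i : Fin p) (F : smoothAlgebra p q) :
    eulerSide σ α (tD σ i F) = 0 := by
  obtain ⟨s, hs⟩ := exists_finset_differential F
  let a : MultiIndex p → smoothAlgebra p q :=
    fun J => (-1 : ℝ) ^ (∑ i, J i) • tDMulti σ J (tD σ i (pU σ α J F))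
  let g : MultiIndex p → MultiIndex p := fun J => J + Pi.single i 1
  have hg : Function.Injective g := add_left_injective _
  have ha : a.support.Finite := by
    refine s.finite_toSet.subset fun J hJ => ?_
    by_contra h
    exact hJ (by simp only [a, pU_eq_zero (hs σ) α h, map_zero, smul_zero])
  let b : MultiIndex p → smoothAlgebra p q :=
    fun J => (-1 : ℝ) ^ (∑ i, J i) • tDMulti σ J (pU σ α J (tD σ i F))
  have h₁ : ∀ K, a (g K) - b (g K) = a K := fun K => by
    simp only [a, b, g, pU_add_single_tD, map_add, smul_add, sub_add_cancel_left,
      tDMulti_add_single, Module.End.mul_apply, sum_add_single, pow_succ, mul_neg_one, neg_smul,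
      neg_neg]
  have h₂ : ∀ J, J ∉ Set.range g → a J - b J = 0 := fun J hJ => by
    have : J i = 0 := by
      by_contra h
      obtain ⟨K, rfl⟩ := exists_eq_add_single h
      exact hJ ⟨K, rfl⟩
    simp only [a, b, pU_tD_of_eq_zero σ α this, sub_self]
  have h₃ : ∑ᶠ J, (a J - b J) = ∑ᶠ J, a J := by
    rw [← finsum_mem_univ, ← finsum_mem_inter_support_eq (fun J => a J - b J) (Set.range g),
      finsum_mem_range hg]
    · exact finsum_congr h₁
    · ext J
      simp only [Set.mem_inter_iff, Set.mem_univ, true_and, Function.mem_support,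
        and_iff_right_iff_imp]
      exact fun h => by_contra fun h' => h (h₂ J h')
  have hb : b.support.Finite := finite_support_eulerSide σ α (tD σ i F)
  rw [finsum_sub_distrib ha hb, sub_eq_self] at h₃
  exact h₃

theorem eulerSide_map {σ : Bool} {T : Module.End ℝ (smoothAlgebra p q)}
    (hD : ∀ i, Commute T (tD σ i)) (hU : ∀ α J, Commute T (pU σ α J)) (α : Fin q)
    (F : smoothAlgebra p q) : eulerSide σ α (T F) = T (eulerSide σ α F) := by
  refine Eq.trans (finsum_congr fun J => ?_)
    (T.toAddMonoidHom.map_finsum (finite_support_eulerSide σ α F)).symm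
  change _ = T (_ • _)
  rw [map_smul]
  have h₁ : T (tDMulti σ J (pU σ α J F)) = tDMulti σ J (T (pU σ α J F)) :=
    DFunLike.congr_fun (commute_tDMulti hD J).eq _
  have h₂ : T (pU σ α J F) = pU σ α J (T F) := DFunLike.congr_fun (hU α J).eq F
  rw [h₁, h₂]

/-! ### Euler kernels, stable subspaces and divergences. -/

/-- The common kernel of the Euler operators in one of the two jets. -/
def eulerKer (p q : ℕ) (σ : Bool) : Submodule ℝ (smoothAlgebra p q) where
  carrier := {F | ∀ α, eulerSide σ α F = 0}
  zero_mem' α := by simp [eulerSide]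
  add_mem' {F G} hF hG α := by
    refine Eq.trans ?_ ((congrArg₂ (· + ·) (hF α) (hG α)).trans (add_zero 0))
    refine Eq.trans (finsum_congr fun J => ?_) (finsum_add_distrib
      (finite_support_eulerSide σ α F) (finite_support_eulerSide σ α G))
    simp only [map_add, smul_add]
  smul_mem' r F hF α :=
    (eulerSide_map (T := LinearMap.lsmul ℝ _ r)
      (fun _ => LinearMap.ext fun F => (map_smul _ r F).symm)
      (fun _ _ => LinearMap.ext fun F => (map_smul _ r F).symm) α F).trans (by rw [hF, map_zero])

theorem mem_eulerKer {σ : Bool} {F : smoothAlgebra p q} :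
    F ∈ eulerKer p q σ ↔ ∀ α, eulerSide σ α F = 0 :=
  Iff.rfl

/-- Operators that act on one of the two jets only. -/
def IsTransverse (σ : Bool) (T : Module.End ℝ (smoothAlgebra p q)) : Prop :=
  ∀ τ, σ ≠ τ → (∀ i, Commute T (tD τ i)) ∧ ∀ α J, Commute T (pU τ α J)

/-- Subspaces stable under all operators that act on one of the two jets only. -/
def IsStable (σ : Bool) (V : Submodule ℝ (smoothAlgebra p q)) : Prop :=
  ∀ T, IsTransverse σ T → ∀ F ∈ V, T F ∈ V

/-- This lets the second Euler equation pass to the components of a divergence in the first jet. -/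
theorem isStable_eulerKer {σ τ : Bool} (h : σ ≠ τ) : IsStable σ (eulerKer p q τ) :=
  fun T hT F hF => mem_eulerKer.2 fun α => by
    rw [eulerSide_map (hT τ h).1 (hT τ h).2, mem_eulerKer.1 hF α, map_zero]

theorem isTransverse_tD (σ : Bool) (i : Fin p) :
    IsTransverse σ (tD σ i : Module.End ℝ (smoothAlgebra p q)) :=
  fun τ h => ⟨commute_tD σ τ i, commute_tD_pU h i⟩

theorem isTransverse_pU (σ : Bool) (α : Fin q) (J : MultiIndex p) :
    IsTransverse σ (pU σ α J) :=
  fun τ h => ⟨fun i => (commute_tD_pU (Ne.symm h) i α J).symm, fun β K => commute_pU σ τ α β J K⟩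

/-- Divergences `∑ i, D_i P_i` with `P_i ∈ V`. -/
def divergences (σ : Bool) (V : Submodule ℝ (smoothAlgebra p q)) :
    Submodule ℝ (smoothAlgebra p q) :=
  Submodule.map (∑ i, tD σ i ∘ₗ LinearMap.proj i) (Submodule.pi Set.univ fun _ : Fin p => V)

theorem mem_divergences {σ : Bool} {V : Submodule ℝ (smoothAlgebra p q)}
    {F : smoothAlgebra p q} : F ∈ divergences σ V ↔
      ∃ P : Fin p → smoothAlgebra p q, (∀ i, P i ∈ V) ∧ ∑ i, tD σ i (P i) = F := by
  simp [divergences]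

theorem tD_mem_divergences (σ : Bool) {V : Submodule ℝ (smoothAlgebra p q)}
    {F : smoothAlgebra p q} (hF : F ∈ V) (i : Fin p) : tD σ i F ∈ divergences σ V := by
  refine mem_divergences.2 ⟨Pi.single i F, fun j => ?_, ?_⟩
  · by_cases h : j = i
    · subst h
      rwa [Pi.single_eq_same]
    · rw [Pi.single_eq_of_ne h]
      exact V.zero_mem
  · rw [Finset.sum_eq_single i (fun j _ h => by rw [Pi.single_eq_of_ne h, map_zero])
      (fun h => absurd (Finset.mem_univ i) h), Pi.single_eq_same]

/-! ### Coordinate functions and integration by parts. -/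

/-- A linear function of one of the two jets, as a smooth function. -/
def coord (σ : Bool) (ℓ : InfJet p q →ₗ[ℝ] ℝ)
    (h : ∃ k, ∀ w, truncL p q k w = 0 → ℓ w = 0) : smoothAlgebra p q :=
  ⟨fun z => ℓ (proj σ z), by
    obtain ⟨k, hk⟩ := h
    refine isSmooth_of_trunc k (ℓ ∘ₗ proj σ ∘ₗ extend p q k) (contDiff_linearMap _) fun z => ?_
    have := hk _ (truncL_proj σ (z := z - extend p q k (trunc p q k z))
      (by rw [map_sub, trunc_extend le_rfl, sub_self]))
    rw [map_sub, map_sub, sub_eq_zero] at this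
    exact this⟩

theorem lie_coord (σ : Bool) (ℓ : InfJet p q →ₗ[ℝ] ℝ)
    (h : ∃ k, ∀ w, truncL p q k w = 0 → ℓ w = 0) (a : BiJet p q)
    {S : BiJet p q →ₗ[ℝ] BiJet p q} (hS : IsLocal S) (z : BiJet p q) :
    (lie a S hS (coord σ ℓ h)).1 z = ℓ (proj σ (a + S z)) := by
  have : ∀ v, HasDerivAt (fun t : ℝ => ℓ (proj σ (z + t • v))) (ℓ (proj σ v)) 0 := fun v => by
    simp only [map_add, map_smul]
    simpa using ((hasDerivAt_id (0 : ℝ)).mul_const (ℓ (proj σ v))).const_add (ℓ (proj σ z))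
  exact (this _).deriv

/-- By the Leibniz rule, since derivations along the other jet kill functions of this one. -/
theorem isTransverse_mulLeft_coord (σ : Bool) (ℓ : InfJet p q →ₗ[ℝ] ℝ)
    (h : ∃ k, ∀ w, truncL p q k w = 0 → ℓ w = 0) :
    IsTransverse σ (LinearMap.mulLeft ℝ (coord σ ℓ h)) := by
  have key : ∀ (a : BiJet p q) {S : BiJet p q →ₗ[ℝ] BiJet p q} (hS : IsLocal S),
      (∀ z, proj σ (a + S z) = 0) →
      Commute (LinearMap.mulLeft ℝ (coord σ ℓ h)) (lie a S hS) := by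
    intro a S hS h₀
    have h₁ : lie a S hS (coord σ ℓ h) = 0 := Subtype.ext <| funext fun z => by
      rw [lie_coord, h₀, map_zero]
      rfl
    refine LinearMap.ext fun F => ?_
    change coord σ ℓ h * lie a S hS F = lie a S hS (coord σ ℓ h * F)
    rw [lie_mul, h₁, zero_mul, zero_add]
  refine fun τ hτ => ⟨fun i => key _ _ fun z => ?_, fun α J => key _ _ fun z => ?_⟩
  · rw [map_add, proj_inj_of_ne hτ, shift, LinearMap.comp_apply, proj_inj_of_ne hτ, add_zero]
  · rw [map_add, proj_inj_of_ne hτ, LinearMap.zero_apply, map_zero, add_zero]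

/-- The jet coordinate `u^α_J`. -/
def coordU (σ : Bool) (α : Fin q) (J : MultiIndex p) : smoothAlgebra p q :=
  coord σ (LinearMap.proj (α, J) ∘ₗ LinearMap.snd ℝ _ _)
    ⟨∑ i, J i, fun _ hw => (truncL_eq_zero_iff.1 hw).2 α J le_rfl⟩

/-- The coordinate `x^i`. -/
def coordX (σ : Bool) (i : Fin p) : smoothAlgebra p q :=
  coord σ (LinearMap.proj i ∘ₗ LinearMap.fst ℝ _ _)
    ⟨0, fun _ hw => congrFun (truncL_eq_zero_iff.1 hw).1 i⟩

theorem proj_shift (σ : Bool) (i : Fin p) (z : BiJet p q) :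
    proj σ (shift σ i z) = shiftL i (proj σ z) :=
  proj_inj σ _

theorem tD_coordU (σ : Bool) (α : Fin q) (J : MultiIndex p) (i : Fin p) :
    tD σ i (coordU σ α J) = coordU σ α (J + Pi.single i 1) := by
  refine Subtype.ext <| funext fun z => (lie_coord σ _ _ _ _ z).trans ?_
  rw [map_add (proj σ), proj_inj, proj_shift]
  exact zero_add _

theorem tD_coordX (σ : Bool) (i : Fin p) :
    tD σ i (coordX σ i : smoothAlgebra p q) = 1 := by
  refine Subtype.ext <| funext fun z => (lie_coord σ _ _ _ _ z).trans ?_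
  rw [map_add (proj σ), proj_inj, proj_shift]
  change Pi.single (M := fun _ => ℝ) i 1 i + 0 = 1
  rw [Pi.single_eq_same, add_zero]

/-- Integration by parts for `u^α_J F`. -/
theorem coordU_mul_sub_mem_divergences {σ : Bool} {V : Submodule ℝ (smoothAlgebra p q)}
    (hV : IsStable σ V) (α : Fin q) (n : ℕ) : ∀ (J : MultiIndex p), ∑ i, J i = n → ∀ F ∈ V,
    coordU σ α J * F - (-1 : ℝ) ^ n • (coordU σ α 0 * tDMulti σ J F) ∈ divergences σ V := by
  induction n with
  | zero =>
    intro J hJ F _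
    obtain rfl : J = 0 := funext fun i => by
      simpa using Finset.sum_eq_zero_iff.1 hJ i (Finset.mem_univ i)
    rw [tDMulti_zero, Module.End.one_apply, pow_zero, one_smul, sub_self]
    exact Submodule.zero_mem _
  | succ n ih =>
    intro J hJ F hF
    obtain ⟨i, -, hi⟩ : ∃ i ∈ Finset.univ, J i ≠ 0 := Finset.exists_ne_zero_of_sum_ne_zero
      (by rw [hJ]; exact n.succ_ne_zero)
    obtain ⟨K, rfl⟩ := exists_eq_add_single hi
    rw [sum_add_single, Nat.succ_inj] at hJ
    have h₁ := ih K hJ (tD σ i F) (hV _ (isTransverse_tD σ i) F hF)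
    have h₂ := tD_mem_divergences σ (hV _ (isTransverse_mulLeft_coord σ _ _) F hF) i
      (F := coordU σ α K * F)
    -- From `D_i (u_K F) = u_{K,i} F + u_K D_i F`, with the induction hypothesis applied to `u_K D_i
    -- F`.
    convert Submodule.sub_mem _ h₂ h₁ using 1
    rw [tD, lie_mul, ← tD, tD_coordU, tDMulti_add_single, Module.End.mul_apply, pow_succ,
      mul_neg_one, neg_smul]
    abel

/-! ### Homotopy operators in one jet. -/

/-- Linear maps of the jet space that lower the order by at most one. -/
def IsLocalJet (P : InfJet p q →ₗ[ℝ] InfJet p q) : Prop :=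
  ∀ k w, truncL p q (k + 1) w = 0 → truncL p q k (P w) = 0

theorem truncL_of_succ {k : ℕ} {w : InfJet p q} (h : truncL p q (k + 1) w = 0) :
    truncL p q k w = 0 := by
  rw [truncL_eq_zero_iff] at h ⊢
  exact ⟨h.1, fun α J hJ => h.2 α J (hJ.trans k.le_succ)⟩

theorem isLocal_id_sub (σ : Bool) {P : InfJet p q →ₗ[ℝ] InfJet p q} (hP : IsLocalJet P) :
    IsLocal (LinearMap.id - inj σ ∘ₗ P ∘ₗ proj σ) := fun k z hz => by
  rw [LinearMap.sub_apply, map_sub, isLocal_inj_comp_proj σ P hP k z hz, sub_zero]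
  exact Prod.ext (truncL_of_succ (congrArg Prod.fst hz)) (truncL_of_succ (congrArg Prod.snd hz))

/-- Averaging over the segment from `a - P a` to `a - P a + R a`, where `a` is one of the two
jets. -/
def averageSide (σ : Bool) {P R : InfJet p q →ₗ[ℝ] InfJet p q} (hP : IsLocalJet P)
    (hR : IsLocalJet R) : Module.End ℝ (smoothAlgebra p q) :=
  average (LinearMap.id - inj σ ∘ₗ P ∘ₗ proj σ) (inj σ ∘ₗ R ∘ₗ proj σ) (isLocal_id_sub σ hP)
    (isLocal_inj_comp_proj σ R hR)

theorem averageSide_apply (σ : Bool) {P R : InfJet p q →ₗ[ℝ] InfJet p q} (hP : IsLocalJet P)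
    (hR : IsLocalJet R) (F : smoothAlgebra p q) (z : BiJet p q) :
    (averageSide σ hP hR F).1 z =
      ∫ t in (0 : ℝ)..1, F.1 (z - inj σ (P (proj σ z)) + t • inj σ (R (proj σ z))) :=
  rfl

theorem isTransverse_averageSide (σ : Bool) {P R : InfJet p q →ₗ[ℝ] InfJet p q}
    (hP : IsLocalJet P) (hR : IsLocalJet R) : IsTransverse σ (averageSide σ hP hR) := by
  refine fun τ hτ => ⟨fun i => ?_, fun α J => ?_⟩
  all_goals
    refine (commute_lie_average _ _ _ ?_ ?_ (fun z => ?_) fun z => ?_).symm <;>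
    simp [shift, proj_inj_of_ne hτ, proj_inj_of_ne hτ.symm]

/-- The fibre component of a jet. -/
def vert (p q : ℕ) : InfJet p q →ₗ[ℝ] InfJet p q := LinearMap.inr ℝ _ _ ∘ₗ LinearMap.snd ℝ _ _

/-- The component of a jet along `x^i`. -/
def horiz (p q : ℕ) (i : Fin p) : InfJet p q →ₗ[ℝ] InfJet p q :=
  LinearMap.inl ℝ _ _ ∘ₗ LinearMap.single ℝ _ i ∘ₗ LinearMap.proj i ∘ₗ LinearMap.fst ℝ _ _

theorem isLocalJet_vert : IsLocalJet (vert p q) := fun _ _ hw =>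
  truncL_eq_zero_iff.2 ⟨rfl, (truncL_eq_zero_iff.1 (truncL_of_succ hw)).2⟩

theorem isLocalJet_horiz (i : Fin p) : IsLocalJet (horiz p q i) := fun _ w hw =>
  truncL_eq_zero_iff.2 ⟨by
    change Pi.single (M := fun _ => ℝ) i (w.1 i) = 0
    rw [(truncL_eq_zero_iff.1 hw).1, Pi.zero_apply, Pi.single_zero], fun _ _ _ => rfl⟩

theorem isLocalJet_zero : IsLocalJet (0 : InfJet p q →ₗ[ℝ] InfJet p q) := fun _ _ _ => by simp

theorem IsLocalJet.add {P R : InfJet p q →ₗ[ℝ] InfJet p q} (hP : IsLocalJet P)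
    (hR : IsLocalJet R) : IsLocalJet (P + R) := fun k w hw => by
  rw [LinearMap.add_apply, map_add, hP k w hw, hR k w hw, add_zero]

/-- The average runs over the maps `(x, u) ↦ (x, tu)`, which preserve the field of `D_i`, as its
fibre part is linear in `u`. -/
theorem commute_averageSide_vert_tD (σ : Bool) (i : Fin p) :
    Commute (averageSide σ isLocalJet_vert isLocalJet_vert)
      (tD σ i : Module.End ℝ (smoothAlgebra p q)) := by
  have h₁ : ∀ w : InfJet p q, vert p q (shiftL i w) = shiftL i w := fun _ => rfl
  have h₂ : ∀ w : InfJet p q, shiftL i (vert p q w) = shiftL i w := fun _ => rfl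
  have h₃ : ∀ a : Fin p → ℝ, vert p q (a, 0) = 0 := fun _ => rfl
  refine (commute_lie_average _ _ _ ?_ ?_ (fun z => ?_) fun z => ?_).symm <;>
  simp [shift, proj_inj, h₁, h₂, h₃]

/-- The fibre homotopy formula. -/
theorem sub_averageSide_vert (σ : Bool) (F : smoothAlgebra p q) {s : Finset (MultiIndex p)}
    (hs : ∀ (z : BiJet p q) (b : Fin q × MultiIndex p → ℝ),
      (∀ α, ∀ J ∈ s, b (α, J) = 0) → differential F z (inj σ (0, b)) = 0) :
    F - averageSide σ isLocalJet_vert isLocalJet_zero F =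
      ∑ α, ∑ J ∈ s, coordU σ α J *
        averageSide σ isLocalJet_vert isLocalJet_vert (pU σ α J F) := by
  let ev : BiJet p q → smoothAlgebra p q →+ ℝ := fun z =>
    (Pi.evalAddMonoidHom _ z).comp (smoothAlgebra p q).val.toAddMonoidHom
  refine Subtype.ext <| funext fun z => ?_
  set c := z - inj σ (vert p q (proj σ z)) with hc
  set v := inj σ (vert p q (proj σ z))
  -- Here `c` is the jet with `u = 0` and `c + t v` the one with fibre `tu`; the fundamental theorem
  -- of calculus in `t` follows.
  have h₁ : ∀ t : ℝ, differential F (c + t • v) v =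
      ∑ α, ∑ J ∈ s, (coordU σ α J).1 z * (pU σ α J F).1 (c + t • v) :=
    fun t => differential_fiber F σ _ (hs _) _
  have h₂ := intervalIntegral.integral_eq_sub_of_hasDerivAt (a := 0) (b := 1)
    (fun t _ => hasDerivAt_comp_segment F c v t)
    ((continuous_differential_segment F c v v).intervalIntegrable _ _)
  rw [one_smul, zero_smul, add_zero, hc, sub_add_cancel, ← hc] at h₂
  have h₃ : (averageSide σ isLocalJet_vert isLocalJet_zero F).1 z = F.1 c := by
    rw [averageSide_apply]
    simp [c]
  change F.1 z - _ = ev z _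
  rw [h₃, ← h₂]
  simp only [h₁, map_sum]
  rw [intervalIntegral.integral_finsetSum]
  · refine Finset.sum_congr rfl fun α _ => ?_
    rw [intervalIntegral.integral_finsetSum]
    · refine Finset.sum_congr rfl fun J _ => ?_
      exact intervalIntegral.integral_const_mul _ _
    · exact fun J _ => (continuous_const.mul
        (continuous_comp_segment (pU σ α J F) c v)).intervalIntegrable _ _
  · exact fun α _ => (continuous_finsetSum _ fun J _ => continuous_const.mul
      (continuous_comp_segment (pU σ α J F) c v)).intervalIntegrable _ _

/-- A function that does not depend on the fibre coordinates is a total derivative. -/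
theorem averageSide_eq_tD (σ : Bool) (i : Fin p) (F : smoothAlgebra p q) :
    averageSide σ isLocalJet_vert isLocalJet_zero F =
      tD σ i (coordX σ i *
        averageSide σ (isLocalJet_vert.add (isLocalJet_horiz i)) (isLocalJet_horiz i) F) := by
  -- With `B` the average of `F` at `u = 0` over `x^i` scaled by `t`, the claim is `F(x,0) = B + x^i
  -- D_i B`, the integral over `[0, 1]` of `d/dt (t F(c + t v))`.
  rw [tD, lie_mul, ← tD, tD_coordX, one_mul]
  refine Subtype.ext <| funext fun z => ?_
  set B := averageSide σ (isLocalJet_vert.add (isLocalJet_horiz i)) (isLocalJet_horiz i) F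
  set w := proj σ z
  set v := inj σ (horiz p q i w)
  set c := z - inj σ ((vert p q + horiz p q i) w)
  set e := inj σ (Pi.single i 1, 0) with he
  have hv : v = w.1 i • e := by
    rw [he, ← map_smul]
    refine congrArg (inj σ) (Prod.ext (funext fun j => ?_) (smul_zero _).symm)
    change Pi.single (M := fun _ => ℝ) i (w.1 i) j = w.1 i * Pi.single (M := fun _ => ℝ) i 1 j
    simp [Pi.single_apply]
  have h₁ : (tD σ i B).1 z = ∫ t in (0 : ℝ)..1, t * differential F (c + t • v) e := by
    refine (differential_average _ _ F z _).trans (intervalIntegral.integral_congr fun t _ => ?_)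
    refine Eq.trans ?_ (map_smul (differential F (c + t • v)) t e)
    -- The scaling kills the fibre part of the field of `D_i` and multiplies its horizontal part `e`
    -- by `t`.
    refine congrArg (differential F (c + t • v)) ?_
    have h₃ : vert p q (Pi.single i 1, 0) = 0 := rfl
    have h₄ : horiz p q i (Pi.single i 1, 0) = (Pi.single i 1, 0) :=
      Prod.ext (congrArg (Pi.single i) (Pi.single_eq_same i 1)) rfl
    have h₅ : vert p q (shiftL i w) = shiftL i w := rfl
    have h₆ : horiz p q i (shiftL i w) = 0 := Prod.ext (Pi.single_zero i) rfl
    simp only [shift, LinearMap.comp_apply, LinearMap.sub_apply, LinearMap.id_apply, map_add,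
      proj_inj, LinearMap.add_apply, h₃, h₄, zero_add, he]
    rw [h₅, h₆, map_zero]
    simp [w]
  have h₂ := intervalIntegral.integral_eq_sub_of_hasDerivAt (a := 0) (b := 1)
    (fun t _ => (hasDerivAt_id' t).mul (hasDerivAt_comp_segment F c v t))
    (Continuous.intervalIntegrable ((continuous_const.mul (continuous_comp_segment F c v)).add
      (continuous_id'.mul (continuous_differential_segment F c v v))) _ _)
  have h₃ : (averageSide σ isLocalJet_vert isLocalJet_zero F).1 z = F.1 (c + v) := by
    have h₄ : z - inj σ (vert p q w) = c + v := by
      simp only [c, v, LinearMap.add_apply, map_add]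
      abel
    rw [averageSide_apply, h₄]
    simp
  change _ = B.1 z + w.1 i * (tD σ i B).1 z
  rw [h₃, h₁, ← intervalIntegral.integral_const_mul, averageSide_apply,
    ← intervalIntegral.integral_add]
  · refine Eq.trans ?_ (h₂.symm.trans (intervalIntegral.integral_congr fun t _ => ?_))
    · simp
    · change 1 * F.1 (c + t • v) + t * differential F (c + t • v) v =
        F.1 (c + t • v) + w.1 i * (t * differential F (c + t • v) e)
      have h₇ : differential F (c + t • v) v = w.1 i * differential F (c + t • v) e :=
        (congrArg (differential F (c + t • v)) hv).trans (map_smul (differential F _) (w.1 i) e)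
      rw [one_mul, mul_left_comm, h₇]
  · exact (continuous_comp_segment F c v).intervalIntegrable _ _
  · exact (continuous_const.mul (continuous_id'.mul
      (continuous_differential_segment F c v e))).intervalIntegrable _ _

/-! ### Exactness, double divergences and the matrix form. -/

/-- The kernel of the Euler operators consists of divergences. -/
theorem mem_divergences_of_mem_eulerKer {σ : Bool} {V : Submodule ℝ (smoothAlgebra p q)}
    (hV : IsStable σ V) (hp : 1 ≤ p) {F : smoothAlgebra p q} (hF : F ∈ V)
    (hE : F ∈ eulerKer p q σ) : F ∈ divergences σ V := by
  obtain ⟨s, hs⟩ := exists_finset_differential F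
  set A := averageSide σ isLocalJet_vert isLocalJet_vert with hA
  have h₁ := sub_averageSide_vert σ F (hs σ)
  rw [← hA] at h₁
  have h₂ : averageSide σ isLocalJet_vert isLocalJet_zero F ∈ divergences σ V := by
    -- One direction suffices, and `p ≥ 1` provides it.
    rw [averageSide_eq_tD σ ⟨0, hp⟩]
    exact tD_mem_divergences σ (hV _ (isTransverse_mulLeft_coord σ _ _) _
      (hV _ (isTransverse_averageSide σ _ _) F hF)) _
  refine (Submodule.sub_mem_iff_left _ h₂).1 ?_
  -- This is `∑ u^α A(E_α F)`, with `A` moved past `D_J`. Subtracting it from the homotopy formula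
  -- leaves exactly the terms handled by integration by parts.
  have h₃ : ∑ α, ∑ J ∈ s, (-1 : ℝ) ^ (∑ i, J i) • (coordU σ α 0 *
      tDMulti σ J (A (pU σ α J F))) = 0 := by
    refine Finset.sum_eq_zero fun α _ => ?_
    have h₄ := congrArg A (mem_eulerKer.1 hE α)
    rw [eulerSide, finsum_eq_sum_of_support_subset (s := s), map_sum, map_zero] at h₄
    · rw [← mul_zero (coordU σ α 0), ← h₄, Finset.mul_sum]
      refine Finset.sum_congr rfl fun J _ => ?_
      rw [map_smul, mul_smul_comm]
      refine congrArg _ (congrArg _ ?_)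
      exact (DFunLike.congr_fun (commute_tDMulti (commute_averageSide_vert_tD σ) J).eq _).symm
    · intro J hJ
      by_contra h
      exact hJ (by simp only [pU_eq_zero (hs σ) α h, map_zero, smul_zero])
  rw [h₁, ← sub_zero (∑ α, _), ← h₃, ← Finset.sum_sub_distrib]
  refine Submodule.sum_mem _ fun α _ => ?_
  rw [← Finset.sum_sub_distrib]
  refine Submodule.sum_mem _ fun J _ => ?_
  exact coordU_mul_sub_mem_divergences hV α _ J rfl _
    (hV _ (isTransverse_averageSide σ _ _) _ (hV _ (isTransverse_pU σ α J) F hF))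

theorem frakD_inl (i : Fin p) (F : smoothAlgebra p q) :
    frakD (Sum.inl i) F.1 = (tD false i F).1 :=
  funext fun z => (tD_apply false i F z).symm

theorem frakD_inr (i : Fin p) (F : smoothAlgebra p q) :
    frakD (Sum.inr i) F.1 = (tD true i F).1 :=
  funext fun z => (tD_apply true i F z).symm

theorem mem_eulerKer_false {F : smoothAlgebra p q} :
    F ∈ eulerKer p q false ↔ ∀ α, euler₁ α F.1 = 0 :=
  forall_congr' fun α => by
    rw [Subtype.ext_iff]
    exact Eq.congr_left (funext fun z => eulerSide_apply false α F z)

theorem mem_eulerKer_true {F : smoothAlgebra p q} :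
    F ∈ eulerKer p q true ↔ ∀ α, euler₂ α F.1 = 0 :=
  forall_congr' fun α => by
    rw [Subtype.ext_iff]
    exact Eq.congr_left (funext fun z => eulerSide_apply true α F z)

/-- A function in the kernel of both Euler operators is a double divergence, and conversely. -/
theorem mem_eulerKer_inf_iff (hp : 1 ≤ p) (F : smoothAlgebra p q) :
    F ∈ eulerKer p q false ⊓ eulerKer p q true ↔
      ∃ B : Fin p → Fin p → smoothAlgebra p q,
        F = ∑ i, ∑ j, tD false i (tD true j (B i j)) := by
  constructor
  · rintro ⟨h₁, h₂⟩
    -- The stable subspace is the kernel of `E^2`, so every `P i` still satisfies the second Euler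
    -- equation.
    obtain ⟨P, hP, rfl⟩ := mem_divergences.1 (mem_divergences_of_mem_eulerKer
      (isStable_eulerKer (by decide : false ≠ true)) hp h₂ h₁)
    have h : ∀ i, P i ∈ divergences true ⊤ := fun i =>
      mem_divergences_of_mem_eulerKer (fun _ _ _ _ => Submodule.mem_top) hp Submodule.mem_top
        (hP i)
    choose B _ hB using fun i => mem_divergences.1 (h i)
    exact ⟨B, by simp only [← hB, map_sum]⟩
  · rintro ⟨B, rfl⟩
    refine ⟨?_, ?_⟩
    · exact Submodule.sum_mem _ fun i _ => Submodule.sum_mem _ fun j _ α => eulerSide_tD _ _ _ _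
    · refine Submodule.sum_mem _ fun i _ => Submodule.sum_mem _ fun j _ α => ?_
      have h : tD false i (tD true j (B i j)) = tD true j (tD false i (B i j)) :=
        DFunLike.congr_fun (commute_tD false true i j).eq _
      rw [h, eulerSide_tD]

/-- The double divergence of `M Q`, for antisymmetric `Q`, in terms of the off-diagonal block. -/
theorem half_sum_frakD (Q : Matrix (Fin p ⊕ Fin p) (Fin p ⊕ Fin p) (smoothAlgebra p q))
    (hQ : ∀ i j, Q j i = -Q i j) :
    (1 / 2 : ℝ) • ∑ i, ∑ j, frakD i (frakD j
      ((matM p q * Q.map Subtype.val : Matrix _ _ (BiJet p q → ℝ)) i j)) =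
      (∑ i, ∑ j, tD false i (tD true j (Q (Sum.inl i) (Sum.inr j))) : smoothAlgebra p q).1 := by
  let D : Fin p ⊕ Fin p → Module.End ℝ (smoothAlgebra p q) := Sum.elim (tD false) (tD true)
  have hD : ∀ i (F : smoothAlgebra p q), frakD i F.1 = (D i F).1 := by
    rintro (i | i) F
    · exact frakD_inl i F
    · exact frakD_inr i F
  have hM : ∀ i j, (matM p q * Q.map Subtype.val : Matrix _ _ (BiJet p q → ℝ)) i j =
      (Sum.elim (fun i => Q (Sum.inl i) j) (fun i => -Q (Sum.inr i) j) i : smoothAlgebra p q).1 := by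
    rintro (i | i) j <;> simp [matM, Matrix.mul_apply, Matrix.one_apply]
  -- Diagonal blocks: exchanging the indices shows that the sum equals its own negative.
  have hc : ∀ (σ : Bool) (R : Fin p → Fin p → smoothAlgebra p q), (∀ i j, R j i = -R i j) →
      ∑ i, ∑ j, tD σ i (tD σ j (R i j)) = 0 := by
    intro σ R hR
    have h : ∀ G : smoothAlgebra p q, G = -G → G = 0 := fun G hG => Subtype.ext <| funext fun z =>
      self_eq_neg.1 (congrFun (congrArg Subtype.val hG) z)
    refine h _ ?_
    conv_lhs => rw [Finset.sum_comm]
    simp only [← Finset.sum_neg_distrib]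
    refine Finset.sum_congr rfl fun i _ => Finset.sum_congr rfl fun j _ => ?_
    rw [hR i j, map_neg, map_neg]
    exact congrArg _ (DFunLike.congr_fun (commute_tD σ σ j i).eq _)
  have h₁ : (∑ i, ∑ j, frakD i (frakD j
      ((matM p q * Q.map Subtype.val : Matrix _ _ (BiJet p q → ℝ)) i j))) =
      (∑ i, ∑ j, D i (D j (Sum.elim (fun i => Q (Sum.inl i) j)
        (fun i => -Q (Sum.inr i) j) i)) : smoothAlgebra p q).1 := by
    simp only [hM, hD]
    change _ = (smoothAlgebra p q).val _
    simp only [map_sum]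
    rfl
  rw [h₁]
  simp only [Fintype.sum_sum_type, Sum.elim_inl, Sum.elim_inr, D, Finset.sum_add_distrib]
  have h₂ := hc false (fun i j => Q (Sum.inl i) (Sum.inl j)) fun i j => hQ _ _
  -- The sign from `M` keeps this block antisymmetric; in the lower-left block it undoes the sign of
  -- antisymmetry, so the mixed terms add up and absorb the factor `1 / 2`.
  have h₃ := hc true (fun i j => -Q (Sum.inr i) (Sum.inr j)) fun i j => congrArg _ (hQ _ _)
  have h₄ : ∑ i, ∑ j, tD true i (tD false j (-Q (Sum.inr i) (Sum.inl j))) =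
      ∑ i, ∑ j, tD false i (tD true j (Q (Sum.inl i) (Sum.inr j))) := by
    rw [Finset.sum_comm]
    refine Finset.sum_congr rfl fun i _ => Finset.sum_congr rfl fun j _ => ?_
    rw [hQ (Sum.inl i), neg_neg]
    exact DFunLike.congr_fun (commute_tD true false j i).eq _
  rw [h₂, h₃, h₄, zero_add, add_zero, ← two_smul ℝ]
  change (1 / 2 : ℝ) • ((2 : ℝ) • _) = _
  rw [smul_smul]
  norm_num

end NonlocalJet

end

theorem mainTheorem3 (p q n m : ℕ) (hp : 1 ≤ p)
    (L : NonlocalJet.Jet p q n × NonlocalJet.Jet p q m → ℝ) (hL : ContDiff ℝ ∞ L) :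
    ((∀ α : Fin q, NonlocalJet.euler₁ α (NonlocalJet.lift L) = 0) ∧
      (∀ α : Fin q, NonlocalJet.euler₂ α (NonlocalJet.lift L) = 0)) ↔
    ∃ Q : Matrix (Fin p ⊕ Fin p) (Fin p ⊕ Fin p)
        (NonlocalJet.InfJet p q × NonlocalJet.InfJet p q → ℝ),
      (∀ i j, NonlocalJet.IsSmooth (Q i j)) ∧
      Q.transpose = -Q ∧
      NonlocalJet.lift L =
        (1 / 2 : ℝ) • ∑ i, ∑ j, NonlocalJet.frakD i (NonlocalJet.frakD j
          ((NonlocalJet.matM p q * Q) i j)) := by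
  let F : NonlocalJet.smoothAlgebra p q := ⟨NonlocalJet.lift L, n, m, L, hL, rfl⟩
  have h := NonlocalJet.mem_eulerKer_inf_iff hp F
  rw [Submodule.mem_inf, NonlocalJet.mem_eulerKer_false, NonlocalJet.mem_eulerKer_true] at h
  refine h.trans ⟨?_, ?_⟩
  · rintro ⟨B, hB⟩
    let Q : Matrix (Fin p ⊕ Fin p) (Fin p ⊕ Fin p) (NonlocalJet.smoothAlgebra p q) :=
      Matrix.fromBlocks 0 (Matrix.of B) (-(Matrix.of B).transpose) 0
    have hQ : ∀ i j, Q j i = -Q i j := by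
      rintro (i | i) (j | j) <;> simp [Q]
    refine ⟨Q.map Subtype.val, fun i j => (Q i j).2, ?_, ?_⟩
    · exact Matrix.ext fun i j => congrArg Subtype.val (hQ i j)
    · rw [NonlocalJet.half_sum_frakD Q hQ]
      exact congrArg Subtype.val hB
  · rintro ⟨Q, hs, hQ, hL'⟩
    let Q' : Matrix (Fin p ⊕ Fin p) (Fin p ⊕ Fin p) (NonlocalJet.smoothAlgebra p q) :=
      fun i j => ⟨Q i j, hs i j⟩
    refine ⟨fun i j => Q' (Sum.inl i) (Sum.inr j), Subtype.ext ?_⟩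
    refine hL'.trans (NonlocalJet.half_sum_frakD Q' fun i j => Subtype.ext ?_)
    exact congrFun (congrFun hQ i) j
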